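/- Let $S$ be a countable set with its discrete $\sigma$-algebra and let $P=(p_{x,y})_{x,y\in S}$ be a transition (stochastic) matrix on $S$. Suppose that $P^n$ converges uniformly to $\pi$, that is, $P$ is irreducible, aperiodic and positive recurrent with stationary distribution $\pi$, and $$\sup_{x\in S}\bigl\|P^n(x,\cdot)-\pi\bigr\|\to 0\qquad (n\to\infty),$$ where $\|\cdot\|$ is the total variation norm, $\|\nu\|=\sum_{y\in S}|\nu(y)|$. Let $(X_t)_{t\in\mathbb Z}$ be any Markov chain with transition matrix $P$ whose time index set is all of $\mathbb Z$, that is, any $S$-valued process on a probability space such that, almost surely, $\mathbb P\bigl(X_{t+1}=y\mid (X_s)_{s\le t}\bigr)=p_{X_t,y}$ for all $t\in\mathbb Z$ and $y\in S$. Then $(X_t)_{t\in\mathbb Z}$ is stationary (the joint law of $(X_{t+k})_{t\in\mathbb Z}$ is the same for every $k\in\mathbb Z$), with $X_t\sim\pi$ for every $t\in\mathbb Z$, and it is bi-recurrent: almost surely, for every $x\in S$, the set $\{t\in\mathbb Z: X_t=x\}$ is unbounded above and below. -/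

import Mathlib

open MeasureTheory ProbabilityTheory Filter Topology
open scoped ENNReal

namespace MarkovZ

/-- A transition matrix on `S` is `P : S → PMF S`, with entries `p_{x,y} = P x y` and rows that are
probability vectors. Its `n`-th power `P ^ n`, whose `x`-th row is `P ^ n (x, ·)`. -/
noncomputable def nStep {S : Type*} (P : S → PMF S) : ℕ → S → PMF S
  | 0, x => PMF.pure x
  | n + 1, x => (P x).bind (nStep P n)

/-- Every state leads to every state with positive probability in some number of steps. -/
def Irreducible {S : Type*} (P : S → PMF S) : Prop :=
  ∀ x y : S, ∃ n : ℕ, 0 < nStep P n x y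

/-- For every state `x`, the greatest common divisor of the possible return times
`{n : P ^ n (x, x) > 0}` is one. (The time `n = 0` is a multiple of every `d`, so that including it
makes no difference.) -/
def Aperiodic {S : Type*} (P : S → PMF S) : Prop :=
  ∀ (x : S) (d : ℕ), (∀ n : ℕ, 0 < nStep P n x x → d ∣ n) → d = 1

/-- `firstPassage P x n y` is the probability that the chain started in `y` at time `0` visits `x`
for the first time after time `0` exactly at time `n`. -/
noncomputable def firstPassage {S : Type*} (P : S → PMF S) (x : S) : ℕ → S → ℝ≥0∞
  | 0, _ => 0
  | 1, y => P y x
  | n + 2, y => ∑' z : {z : S // z ≠ x}, P y z * firstPassage P x (n + 1) z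

/-- Started in any state `x`, the chain almost surely returns to `x`, and its expected return time
is finite. -/
def PositiveRecurrent {S : Type*} (P : S → PMF S) : Prop :=
  ∀ x : S, ∑' n : ℕ, firstPassage P x n x = 1 ∧
    ∑' n : ℕ, (n : ℝ≥0∞) * firstPassage P x n x < ∞

/-- `π P = π`. -/
def IsStationaryDistribution {S : Type*} (P : S → PMF S) (π : PMF S) : Prop :=
  π.bind P = π

/-- The total variation norm `‖p - q‖ = ∑ y, |p y - q y|` of the difference of two probability
vectors. -/
noncomputable def tvNorm {S : Type*} (p q : PMF S) : ℝ≥0∞ :=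
  ∑' y : S, ENNReal.ofReal |(p y).toReal - (q y).toReal|

/-- `P ^ n` converges uniformly to `π` as `n → ∞`. -/
structure ConvergesUniformly {S : Type*} (P : S → PMF S) (π : PMF S) : Prop where
  irreducible : Irreducible P
  aperiodic : Aperiodic P
  positiveRecurrent : PositiveRecurrent P
  stationary : IsStationaryDistribution P π
  tendsto : Tendsto (fun n : ℕ => ⨆ x : S, tvNorm (nStep P n x) π) atTop (𝓝 0)

/-- The `σ`-algebra generated by `(X_s)_{s ≤ t}`. -/
abbrev past {Ω S : Type*} [MeasurableSpace S] (X : ℤ → Ω → S) (t : ℤ) : MeasurableSpace Ω :=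
  ⨆ s : ℤ, ⨆ _ : s ≤ t, MeasurableSpace.comap (X s) inferInstance

/-- `(X_t)_{t ∈ ℤ}` is a Markov chain with transition matrix `P`: almost surely
`ℙ (X_{t+1} = y | (X_s)_{s ≤ t}) = p_{X_t, y}` for all `t ∈ ℤ` and `y ∈ S`. -/
structure IsMarkovChain {Ω S : Type*} [MeasurableSpace Ω] [MeasurableSpace S]
    (P : S → PMF S) (X : ℤ → Ω → S) (μ : Measure Ω) : Prop where
  measurable : ∀ t : ℤ, Measurable (X t)
  condProb : ∀ (t : ℤ) (y : S),
    μ⟦X (t + 1) ⁻¹' {y}|past X t⟧ =ᵐ[μ] fun ω => (P (X t ω) y).toReal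

/-- The law of the whole process `(X_t)_{t ∈ ℤ}` is invariant under all time shifts. -/
def IsStationary {Ω S : Type*} [MeasurableSpace Ω] [MeasurableSpace S]
    (X : ℤ → Ω → S) (μ : Measure Ω) : Prop :=
  ∀ k : ℤ, IdentDistrib (fun ω (t : ℤ) => X (t + k) ω) (fun ω (t : ℤ) => X t ω) μ μ

/-- The sequence `x` visits every state at times that are unbounded above and below. -/
def BiRecurrentSeq {S : Type*} (x : ℤ → S) : Prop :=
  ∀ y : S, ¬ BddAbove {t : ℤ | x t = y} ∧ ¬ BddBelow {t : ℤ | x t = y}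

/-- Almost every trajectory is bi-recurrent. -/
def IsBiRecurrent {Ω S : Type*} [MeasurableSpace Ω] (X : ℤ → Ω → S) (μ : Measure Ω) : Prop :=
  ∀ᵐ ω ∂μ, BiRecurrentSeq (fun t => X t ω)

end MarkovZ

namespace MarkovZ

variable {S : Type*} {P : S → PMF S} {π : PMF S}

/-! The chain has no initial time, so for each `n` the variable `X t` is reached from `X (t - n)` in
`n` steps. The law of `X (t - n)` is unknown, but all rows of `P ^ n` are uniformly close to `π`, so
any average of them is too; letting `n` grow gives `X t ∼ π`
(`IsMarkovChain.measure_preimage_singleton`). The Markov property then fixes the law of every finite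
window independently of its position, and windows determine the law of the process.

For recurrence, uniformity gives one `n` and one `δ > 0` such that `y` is hit after `n` steps with
probability at least `δ` from everywhere. Hence `k` trials spaced `n` apart all miss `y` with
probability at most `(1 - δ) ^ k`, wherever on the time axis they lie
(`IsMarkovChain.measure_avoid_le`). -/

theorem nStep_succ_apply (P : S → PMF S) (n : ℕ) (x y : S) :
    nStep P (n + 1) x y = ∑' z, P x z * nStep P n z y := by
  simp [nStep, PMF.bind_apply]

theorem IsStationaryDistribution.bind_nStep (h : IsStationaryDistribution P π) (n : ℕ) :
    π.bind (nStep P n) = π := by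
  induction n with
  | zero => exact PMF.bind_pure π
  | succ n ih =>
    have : nStep P (n + 1) = fun x => (P x).bind (nStep P n) := rfl
    rw [this, ← PMF.bind_bind, show π.bind P = π from h, ih]

theorem IsStationaryDistribution.pos (h : IsStationaryDistribution P π) (hP : Irreducible P)
    (y : S) : 0 < π y := by
  obtain ⟨x, hx⟩ := π.support_nonempty
  obtain ⟨n, hn⟩ := hP x y
  rw [← h.bind_nStep n, PMF.bind_apply]
  have hx0 : π x ≠ 0 := hx
  exact (ENNReal.mul_pos hx0 hn.ne').trans_le (ENNReal.le_tsum (f := fun z => π z * nStep P n z y) x)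

/-- Total variation distance dominates pointwise differences. -/
theorem apply_le_apply_add_tvNorm (p q : PMF S) (y : S) :
    p y ≤ q y + tvNorm p q ∧ q y ≤ p y + tvNorm p q := by
  have key : ENNReal.ofReal |(p y).toReal - (q y).toReal| ≤ tvNorm p q :=
    ENNReal.le_tsum (f := fun y => ENNReal.ofReal |(p y).toReal - (q y).toReal|) y
  have aux : ∀ a b : ℝ≥0∞, a ≠ ∞ → b ≠ ∞ → a ≤ b + ENNReal.ofReal |a.toReal - b.toReal| := by
    intro a b ha hb
    conv_lhs => rw [← ENNReal.ofReal_toReal ha]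
    conv_rhs => rw [← ENNReal.ofReal_toReal hb]
    rw [ENNReal.toReal_ofReal ENNReal.toReal_nonneg,
      ← ENNReal.ofReal_add ENNReal.toReal_nonneg (abs_nonneg _)]
    exact ENNReal.ofReal_le_ofReal (by linarith [le_abs_self (a.toReal - b.toReal)])
  constructor
  · exact (aux _ _ (p.apply_ne_top y) (q.apply_ne_top y)).trans (by gcongr)
  · refine (aux _ _ (q.apply_ne_top y) (p.apply_ne_top y)).trans ?_
    rw [abs_sub_comm]
    gcongr

theorem ConvergesUniformly.exists_nStep_close (hP : ConvergesUniformly P π) {ε : ℝ≥0∞}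
    (hε : 0 < ε) : ∃ n, ∀ x y, nStep P n x y ≤ π y + ε ∧ π y ≤ nStep P n x y + ε := by
  obtain ⟨n, hn⟩ := (hP.tendsto.eventually (Iic_mem_nhds hε)).exists
  refine ⟨n, fun x y => ?_⟩
  have hx : tvNorm (nStep P n x) π ≤ ε := (le_iSup (fun x => tvNorm (nStep P n x) π) x).trans hn
  obtain ⟨h1, h2⟩ := apply_le_apply_add_tvNorm (nStep P n x) π y
  exact ⟨h1.trans (by gcongr), h2.trans (by gcongr)⟩

/-- Irreducibility makes `π y` positive, so a uniform error of `π y / 2` leaves at least `π y / 2`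
in every row. -/
theorem ConvergesUniformly.exists_uniform_lower_bound (hP : ConvergesUniformly P π) (y : S) :
    ∃ n : ℕ, ∃ δ : ℝ≥0∞, 0 < δ ∧ ∀ x, δ ≤ nStep P n x y := by
  have hy := hP.stationary.pos hP.irreducible y
  have hε := ENNReal.half_pos hy.ne'
  obtain ⟨n, hn⟩ := hP.exists_nStep_close hε
  refine ⟨n, π y / 2, hε, fun x => ?_⟩
  have h := (hn x y).2
  nth_rewrite 1 [← ENNReal.add_halves (π y)] at h
  exact (ENNReal.add_le_add_iff_right
    (ENNReal.div_ne_top (π.apply_ne_top y) two_ne_zero)).1 h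

/-- The sequences that agree with a given one on some interval `[-n, n]`. -/
def symmetricWindows (S : Type*) : Set (Set (ℤ → S)) :=
  {W | ∃ (n : ℕ) (h : ℤ → S), W = {f | ∀ i ∈ Finset.Icc (-n : ℤ) n, f i = h i}}

/-- Symmetric intervals are nested, so of two windows with a common point the longer lies in the
shorter. -/
theorem isPiSystem_symmetricWindows : IsPiSystem (symmetricWindows S) := by
  have aux : ∀ {n m : ℕ} (f h h' : ℤ → S), n ≤ m →
      (∀ i ∈ Finset.Icc (-n : ℤ) n, f i = h i) → (∀ i ∈ Finset.Icc (-m : ℤ) m, f i = h' i) →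
      {f : ℤ → S | ∀ i ∈ Finset.Icc (-m : ℤ) m, f i = h' i} ⊆
        {f : ℤ → S | ∀ i ∈ Finset.Icc (-n : ℤ) n, f i = h i} := by
    intro n m f h h' hnm hf hf' k hk i hi
    have hi' : i ∈ Finset.Icc (-m : ℤ) m := by
      rw [Finset.mem_Icc] at hi ⊢
      lia
    rw [hk i hi', ← hf' i hi', hf i hi]
  rintro _ ⟨n, h, rfl⟩ _ ⟨m, h', rfl⟩ ⟨f, hf, hf'⟩
  rcases le_total n m with hnm | hnm
  · exact ⟨m, h', Set.inter_eq_right.2 (aux f h h' hnm hf hf')⟩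
  · exact ⟨n, h, Set.inter_eq_left.2 (aux f h' h hnm hf' hf)⟩

/-! ### The Markov property on past events -/

variable {Ω : Type*} [MeasurableSpace S] {X : ℤ → Ω → S}

theorem past_mono (X : ℤ → Ω → S) {s t : ℤ} (h : s ≤ t) : past X s ≤ past X t :=
  iSup₂_le fun r hr => le_iSup₂ (f := fun r (_ : r ≤ t) =>
    MeasurableSpace.comap (X r) inferInstance) r (hr.trans h)

theorem measurableSet_past_preimage (X : ℤ → Ω → S) {s t : ℤ} (h : s ≤ t) {B : Set S}
    (hB : MeasurableSet B) : MeasurableSet[past X t] (X s ⁻¹' B) :=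
  le_iSup₂ (f := fun r (_ : r ≤ t) => MeasurableSpace.comap (X r) inferInstance) s h _
    ⟨B, hB, rfl⟩

theorem measurableSet_past_window [DiscreteMeasurableSpace S] (X : ℤ → Ω → S) (a : ℤ) (n : ℕ) (g : ℕ → S) :
    MeasurableSet[past X (a + n)] {ω | ∀ i ≤ n, X (a + i) ω = g i} := by
  simp only [Set.ofPred_forall]
  exact MeasurableSet.iInter fun i => MeasurableSet.iInter fun hi =>
    measurableSet_past_preimage X (by lia) (measurableSet_singleton (g i))

variable [MeasurableSpace Ω] {μ : Measure Ω}

theorem IsMarkovChain.past_le (hX : IsMarkovChain P X μ) (t : ℤ) : past X t ≤ ‹_› :=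
  iSup₂_le fun s _ => (hX.measurable s).comap_le

variable [DiscreteMeasurableSpace S]

theorem tsum_measure_inter_preimage_singleton [Countable S] {Z : Ω → S} (hZ : Measurable Z)
    {A : Set Ω} (hA : MeasurableSet A) : ∑' x, μ (A ∩ Z ⁻¹' {x}) = μ A := by
  rw [← measure_iUnion]
  · rw [← Set.inter_iUnion, ← Set.preimage_iUnion, Set.iUnion_of_singleton, Set.preimage_univ,
      Set.inter_univ]
  · intro x y hxy
    exact ((Set.disjoint_singleton.2 hxy).preimage Z).mono Set.inter_subset_right
      Set.inter_subset_right
  · exact fun x => hA.inter (hZ (measurableSet_singleton x))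

variable [IsProbabilityMeasure μ]

/-- The conditional probability is integrated over `A ∩ {X t = x}`, where it is almost surely the
constant `P x y`. -/
theorem IsMarkovChain.measure_step (hX : IsMarkovChain P X μ) {t : ℤ} {A : Set Ω}
    (hA : MeasurableSet[past X t] A) (x y : S) :
    μ (A ∩ X t ⁻¹' {x} ∩ X (t + 1) ⁻¹' {y}) = μ (A ∩ X t ⁻¹' {x}) * P x y := by
  set B := A ∩ X t ⁻¹' {x}
  have hB : MeasurableSet[past X t] B :=
    hA.inter (measurableSet_past_preimage X le_rfl (measurableSet_singleton x))
  have hB' : MeasurableSet B := hX.past_le t _ hB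
  have hy : MeasurableSet (X (t + 1) ⁻¹' {y}) := hX.measurable _ (measurableSet_singleton y)
  have h1 := setIntegral_condExp (μ := μ) (hX.past_le t)
    (f := (X (t + 1) ⁻¹' {y}).indicator fun _ => (1 : ℝ))
    ((integrable_const 1).indicator hy) hB
  rw [setIntegral_congr_ae₀ (g := fun _ => (P x y).toReal) hB'.nullMeasurableSet ?_] at h1
  · rw [setIntegral_const, setIntegral_indicator hy, setIntegral_const, smul_eq_mul, smul_eq_mul,
      mul_one] at h1
    rw [← ENNReal.toReal_eq_toReal_iff' (measure_ne_top _ _)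
      (ENNReal.mul_ne_top (measure_ne_top _ _) ((P x).apply_ne_top y)), ENNReal.toReal_mul]
    exact h1.symm
  · filter_upwards [hX.condProb t y] with ω hω hωB
    have : X t ω = x := hωB.2
    rw [← this]
    exact hω

variable [Countable S]

theorem IsMarkovChain.measure_nStep (hX : IsMarkovChain P X μ) (n : ℕ) {t : ℤ} {A : Set Ω}
    (hA : MeasurableSet[past X t] A) (x y : S) :
    μ (A ∩ X t ⁻¹' {x} ∩ X (t + n) ⁻¹' {y}) = μ (A ∩ X t ⁻¹' {x}) * nStep P n x y := by
  classical
  induction n generalizing t A x with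
  | zero =>
    simp only [nStep, PMF.pure_apply, Nat.cast_zero, add_zero, Set.inter_assoc,
      ← Set.preimage_inter]
    split_ifs with h
    · simp [h]
    · rw [Set.singleton_inter_eq_empty.2 (by simpa using Ne.symm h)]
      simp
  | succ n ih =>
    -- The first step is split off, and `A ∩ {X t = x}` serves as the past event at time `t + 1`.
    have hB : MeasurableSet[past X t] (A ∩ X t ⁻¹' {x}) :=
      hA.inter (measurableSet_past_preimage X le_rfl (measurableSet_singleton x))
    have hB' : MeasurableSet[past X (t + 1)] (A ∩ X t ⁻¹' {x}) :=
      past_mono X (by lia) _ hB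
    have hC : MeasurableSet (A ∩ X t ⁻¹' {x} ∩ X (t + (n + 1 : ℕ)) ⁻¹' {y}) :=
      (hX.past_le t _ hB).inter (hX.measurable _ (measurableSet_singleton y))
    rw [← tsum_measure_inter_preimage_singleton (hX.measurable (t + 1)) hC, nStep_succ_apply,
      ← ENNReal.tsum_mul_left]
    refine tsum_congr fun z => ?_
    rw [Set.inter_right_comm, show t + ((n + 1 : ℕ) : ℤ) = t + 1 + n by push_cast; ring,
      ih hB' z, hX.measure_step hA, mul_assoc]

theorem IsMarkovChain.measure_preimage_singleton (hP : ConvergesUniformly P π)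
    (hX : IsMarkovChain P X μ) (t : ℤ) (y : S) : μ (X t ⁻¹' {y}) = π y := by
  have key : ∀ n : ℕ, μ (X t ⁻¹' {y}) = ∑' x, μ (X (t - n) ⁻¹' {x}) * nStep P n x y := by
    intro n
    rw [← tsum_measure_inter_preimage_singleton (hX.measurable (t - n))
      (hX.measurable t (measurableSet_singleton y))]
    refine tsum_congr fun x => ?_
    have := hX.measure_nStep n (t := t - n) MeasurableSet.univ x y
    rw [Set.univ_inter, sub_add_cancel] at this
    rw [Set.inter_comm, this]
  -- Averaging against the unknown law of `X s` preserves constants, so the uniform error `ε` does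
  -- not grow.
  have hone : ∀ s c, ∑' x, μ (X s ⁻¹' {x}) * c = c := by
    intro s c
    have := tsum_measure_inter_preimage_singleton (μ := μ) (hX.measurable s) MeasurableSet.univ
    simp only [Set.univ_inter, measure_univ] at this
    rw [ENNReal.tsum_mul_right, this, one_mul]
  refine le_antisymm (ENNReal.le_of_forall_pos_le_add fun ε hε _ => ?_)
    (ENNReal.le_of_forall_pos_le_add fun ε hε _ => ?_) <;>
  obtain ⟨n, hn⟩ := hP.exists_nStep_close (ENNReal.coe_pos.2 hε)
  · rw [key n]
    calc _ ≤ ∑' x, μ (X (t - n) ⁻¹' {x}) * (π y + ε) := by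
          gcongr with x
          exact (hn x y).1
      _ = _ := hone _ _
  · rw [key n]
    calc π y = ∑' x, μ (X (t - n) ⁻¹' {x}) * π y := (hone _ _).symm
      _ ≤ ∑' x, μ (X (t - n) ⁻¹' {x}) * (nStep P n x y + ε) := by
          gcongr with x
          exact (hn x y).2
      _ = _ := by simp only [mul_add, ENNReal.tsum_add, hone]

theorem IsMarkovChain.map_eq (hP : ConvergesUniformly P π) (hX : IsMarkovChain P X μ) (t : ℤ) :
    μ.map (X t) = π.toMeasure := by
  refine Measure.ext_of_singleton fun y => ?_
  rw [Measure.map_apply (hX.measurable t) (measurableSet_singleton y),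
    PMF.toMeasure_apply_singleton _ _ (measurableSet_singleton y),
    hX.measure_preimage_singleton hP]

/-- The law of finitely many consecutive values. -/
theorem IsMarkovChain.measure_window (hP : ConvergesUniformly P π) (hX : IsMarkovChain P X μ)
    (a : ℤ) (n : ℕ) (g : ℕ → S) :
    μ {ω | ∀ i ≤ n, X (a + i) ω = g i} =
      π (g 0) * ∏ i ∈ Finset.range n, P (g i) (g (i + 1)) := by
  induction n with
  | zero =>
    rw [Finset.range_zero, Finset.prod_empty, mul_one, ← hX.measure_preimage_singleton hP a]
    congr 1
    ext ω
    simp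
  | succ n ih =>
    rw [Finset.prod_range_succ, ← mul_assoc, ← ih]
    have h := hX.measure_step (measurableSet_past_window X a n g) (g n) (g (n + 1))
    have hinter : {ω | ∀ i ≤ n, X (a + i) ω = g i} ∩ X (a + n) ⁻¹' {g n} =
        {ω | ∀ i ≤ n, X (a + i) ω = g i} :=
      Set.inter_eq_left.2 fun ω hω => hω n le_rfl
    rw [hinter] at h
    rw [← h]
    congr 1
    ext ω
    simp only [Set.mem_ofPred_eq, Set.mem_inter_iff, Set.mem_preimage, Set.mem_singleton_iff,
      Nat.le_succ_iff, or_imp, forall_and, forall_eq]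
    push_cast
    rw [add_assoc]

theorem generateFrom_symmetricWindows :
    (MeasurableSpace.pi : MeasurableSpace (ℤ → S)) =
      MeasurableSpace.generateFrom (symmetricWindows S) := by
  apply le_antisymm
  · refine iSup_le fun t => ?_
    rw [← measurable_iff_comap_le]
    have ht : t ∈ Finset.Icc (-(t.natAbs : ℤ)) t.natAbs := by
      rw [Finset.mem_Icc]
      lia
    -- Evaluation at `t` factors through restriction to a finite interval. The restrictions form a
    -- countable set, so measurability reduces to fibres, and a nonempty fibre is a window.
    let r : (ℤ → S) → (Finset.Icc (-(t.natAbs : ℤ)) t.natAbs → S) := fun f i => f i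
    have hr : Measurable[MeasurableSpace.generateFrom (symmetricWindows S)] r := by
      refine @measurable_to_countable' _ _ _ _ (_) _ fun g => ?_
      rcases (r ⁻¹' {g}).eq_empty_or_nonempty with he | ⟨f, rfl⟩
      · rw [he]
        exact @MeasurableSet.empty _ (_)
      · refine MeasurableSpace.measurableSet_generateFrom ⟨t.natAbs, f, ?_⟩
        ext k
        simp [r, funext_iff]
    exact (measurable_pi_apply (⟨t, ht⟩ : Finset.Icc (-(t.natAbs : ℤ)) t.natAbs)).comp hr
  · refine MeasurableSpace.generateFrom_le ?_
    rintro _ ⟨n, h, rfl⟩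
    simp only [Set.ofPred_forall]
    refine MeasurableSet.iInter fun i => MeasurableSet.iInter fun _ => ?_
    have hi : MeasurableSet ((fun f : ℤ → S => f i) ⁻¹' {h i}) :=
      measurable_pi_apply i (measurableSet_singleton (h i))
    exact hi

theorem IsMarkovChain.isStationary (hP : ConvergesUniformly P π) (hX : IsMarkovChain P X μ) :
    IsStationary X μ := by
  intro k
  have hmeas : ∀ k : ℤ, Measurable fun ω (t : ℤ) => X (t + k) ω :=
    fun k => measurable_pi_lambda _ fun t => hX.measurable _
  have hmeas0 : Measurable fun ω (t : ℤ) => X t ω :=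
    measurable_pi_lambda _ fun t => hX.measurable _
  refine ⟨(hmeas k).aemeasurable, hmeas0.aemeasurable, ?_⟩
  have : IsProbabilityMeasure (μ.map fun ω (t : ℤ) => X (t + k) ω) :=
    Measure.isProbabilityMeasure_map (hmeas k).aemeasurable
  have : IsProbabilityMeasure (μ.map fun ω (t : ℤ) => X t ω) :=
    Measure.isProbabilityMeasure_map hmeas0.aemeasurable
  refine ext_of_generate_finite _ generateFrom_symmetricWindows isPiSystem_symmetricWindows ?_
    (by simp only [measure_univ])
  intro W hW
  have hWm : MeasurableSet W := by
    rw [generateFrom_symmetricWindows]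
    exact MeasurableSpace.measurableSet_generateFrom hW
  obtain ⟨n, h, rfl⟩ := hW
  -- Reindexing by `i + n` makes the window start at `-n + a`; its probability does not involve `a`.
  have key : ∀ a : ℤ, {ω | ∀ i ∈ Finset.Icc (-n : ℤ) n, X (i + a) ω = h i} =
      {ω | ∀ i ≤ 2 * n, X (-n + a + i) ω = h (-n + i)} := by
    intro a
    ext ω
    simp only [Set.mem_ofPred_eq, Finset.mem_Icc]
    constructor
    · intro H i hi
      rw [← H (-n + i) (by lia)]
      congr 1
      ring
    · intro H i hi
      have := H (i + n).toNat (by lia)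
      rw [Int.toNat_of_nonneg (by lia)] at this
      convert this using 2 <;> ring
  have key0 := key 0
  simp only [add_zero] at key0
  rw [Measure.map_apply (hmeas k) hWm, Measure.map_apply hmeas0 hWm]
  simp only [Set.preimage_ofPred_eq]
  rw [key, key0, hX.measure_window hP _ _ fun i => h (-n + i),
    hX.measure_window hP _ _ fun i => h (-n + i)]

/-! ### Recurrence in both time directions -/

theorem IsMarkovChain.measure_inter_ne_le (hX : IsMarkovChain P X μ) {n : ℕ} {y : S}
    {δ : ℝ≥0∞} (hδ : ∀ x, δ ≤ nStep P n x y) {t : ℤ} {A : Set Ω}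
    (hA : MeasurableSet[past X t] A) :
    μ (A ∩ {ω | X (t + n) ω ≠ y}) ≤ (1 - δ) * μ A := by
  have hA' : MeasurableSet A := hX.past_le t _ hA
  have hy : MeasurableSet (X (t + n) ⁻¹' {y}) := hX.measurable _ (measurableSet_singleton y)
  have h1 : δ * μ A ≤ μ (A ∩ X (t + n) ⁻¹' {y}) := by
    rw [← tsum_measure_inter_preimage_singleton (hX.measurable t) hA',
      ← tsum_measure_inter_preimage_singleton (hX.measurable t) (hA'.inter hy),
      ← ENNReal.tsum_mul_left]
    refine ENNReal.tsum_le_tsum fun x => ?_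
    rw [Set.inter_right_comm, hX.measure_nStep n hA, mul_comm]
    gcongr
    exact hδ x
  have h2 : A ∩ {ω | X (t + n) ω ≠ y} = A \ (A ∩ X (t + n) ⁻¹' {y}) := by
    ext ω
    simp
  rw [h2, measure_sdiff Set.inter_subset_left (hA'.inter hy).nullMeasurableSet
    (measure_ne_top _ _), ENNReal.sub_mul fun _ _ => measure_ne_top _ _, one_mul]
  exact tsub_le_tsub_left h1 _

theorem IsMarkovChain.measure_avoid_le (hX : IsMarkovChain P X μ) {n : ℕ} {y : S}
    {δ : ℝ≥0∞} (hδ : ∀ x, δ ≤ nStep P n x y) (t : ℤ) (k : ℕ) :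
    μ {ω | ∀ j < k, X (t + (j + 1 : ℕ) * n) ω ≠ y} ≤ (1 - δ) ^ k := by
  induction k with
  | zero => simp
  | succ k ih =>
    -- The first `k` trials are known by time `t + k * n`, so the next one fails with conditional
    -- probability at most `1 - δ`.
    have hA : MeasurableSet[past X (t + k * n)]
        {ω | ∀ j < k, X (t + (j + 1 : ℕ) * n) ω ≠ y} := by
      simp only [Set.ofPred_forall]
      refine MeasurableSet.iInter fun j => MeasurableSet.iInter fun hj =>
        measurableSet_past_preimage X (B := {y}ᶜ) ?_ (measurableSet_singleton y).compl
      gcongr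
      exact hj
    calc _ = μ ({ω | ∀ j < k, X (t + (j + 1 : ℕ) * n) ω ≠ y} ∩
            {ω | X (t + k * n + n) ω ≠ y}) := by
          congr 1
          ext ω
          simp only [Set.mem_ofPred_eq, Set.mem_inter_iff, Nat.lt_succ_iff_lt_or_eq, or_imp,
            forall_and, forall_eq]
          rw [show t + ((k + 1 : ℕ) : ℤ) * n = t + k * n + n by push_cast; ring]
      _ ≤ (1 - δ) * (1 - δ) ^ k := (hX.measure_inter_ne_le hδ hA).trans (by gcongr)
      _ = _ := (pow_succ' _ _).symm

theorem IsMarkovChain.isBiRecurrent (hP : ConvergesUniformly P π) (hX : IsMarkovChain P X μ) :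
    IsBiRecurrent X μ := by
  refine ae_all_iff.2 fun y => ?_
  obtain ⟨n, δ, hδ0, hδ⟩ := hP.exists_uniform_lower_bound y
  have hlim : Tendsto (fun k : ℕ => (1 - δ) ^ k) atTop (𝓝 0) :=
    ENNReal.tendsto_pow_atTop_nhds_zero_of_lt_one
      (ENNReal.sub_lt_self ENNReal.one_ne_top one_ne_zero hδ0.ne')
  have hup : ∀ t : ℤ, ∀ᵐ ω ∂μ, ¬ ∀ s, t ≤ s → X s ω ≠ y := by
    intro t
    rw [ae_iff]
    simp only [not_not]
    refine le_antisymm (ge_of_tendsto' hlim fun k => ?_) zero_le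
    refine (measure_mono fun ω hω j _ => ?_).trans (hX.measure_avoid_le hδ t k)
    exact hω _ (le_add_of_nonneg_right (by positivity))
  have hdown : ∀ t : ℤ, ∀ᵐ ω ∂μ, ¬ ∀ s, s ≤ t → X s ω ≠ y := by
    intro t
    rw [ae_iff]
    simp only [not_not]
    refine le_antisymm (ge_of_tendsto' hlim fun k => ?_) zero_le
    -- Starting at `t - k * n` puts all `k` trials at times at most `t`; no time reversal is needed.
    refine (measure_mono fun ω hω j hj => ?_).trans (hX.measure_avoid_le hδ (t - k * n) k)
    refine hω _ ?_
    have : ((j + 1 : ℕ) : ℤ) * n ≤ k * n := by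
      gcongr
      exact hj
    linarith
  filter_upwards [ae_all_iff.2 hup, ae_all_iff.2 hdown] with ω h1 h2
  constructor
  · rintro ⟨b, hb⟩
    exact h1 (b + 1) fun s hs hsy => absurd (hb hsy) (by lia)
  · rintro ⟨b, hb⟩
    exact h2 (b - 1) fun s hs hsy => absurd (hb hsy) (by lia)

end MarkovZ

theorem mainTheorem7 {S : Type*} [Countable S] [MeasurableSpace S] [DiscreteMeasurableSpace S]
    (P : S → PMF S) (π : PMF S) (hP : MarkovZ.ConvergesUniformly P π)
    {Ω : Type*} [MeasurableSpace Ω] (μ : Measure Ω) [IsProbabilityMeasure μ]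
    (X : ℤ → Ω → S) (hX : MarkovZ.IsMarkovChain P X μ) :
    MarkovZ.IsStationary X μ ∧ (∀ t : ℤ, μ.map (X t) = π.toMeasure) ∧
      MarkovZ.IsBiRecurrent X μ :=
  ⟨hX.isStationary hP, hX.map_eq hP, hX.isBiRecurrent hP⟩
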